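/- A set $S\subseteq\mathbb{Z}$ has the two-sided SML property if it is the union of finitely many complete arithmetic progressions $\{an+b : n\in\mathbb{Z}\}$ ($a,b\in\mathbb{Z}$, with $a=0$ allowed) and a finite set. Let $K$ be a field of characteristic $0$. (1) Let $A$ be a finitely generated commutative $K$-algebra, $\sigma\colon A\to A$ a $K$-algebra automorphism, and $I$, $J$ ideals of $A$. Then $$S(I,J)=\{n\in\mathbb{Z} : \sigma^n(I)\supseteq J\},\qquad \sigma^n(I)=\{\sigma^n(a): a\in I\},$$ has the two-sided SML property. (2) Let $X$ be an affine scheme of finite type over $K$, $\sigma\in\mathrm{Aut}_K(X)$, and $Y$, $Z$ closed subschemes of $X$. Then $$S(Z,Y)=\{n\in\mathbb{Z} : \sigma^n(Z)\subseteq Y\}$$ has the two-sided SML property, where $\subseteq$ denotes inclusion of closed subschemes; that is, $\sigma^n(Z)\subseteq Y$ means that the composite $Z\hookrightarrow X\xrightarrow{\sigma^n}X$ factors through the closed immersion $Y\hookrightarrow X$. -/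

import Mathlib

universe u v

open CategoryTheory AlgebraicGeometry

/-- A set of integers has the two-sided SML property if it is a finite union of complete arithmetic
progressions `{a n + b : n ∈ ℤ}`, augmented by a finite set (both possibly empty). The value
`a = 0`, which gives a one-element set, is allowed; it adds nothing beyond the finite set. -/
def HasTwoSidedSML (S : Set ℤ) : Prop :=
  ∃ (P : Finset (ℤ × ℤ)) (F : Set ℤ), F.Finite ∧
    S = (⋃ p ∈ P, {m : ℤ | ∃ n : ℤ, m = p.1 * n + p.2}) ∪ F

/-- For closed immersions `i : Z ⟶ X` and `j : Y ⟶ X`: the closed subscheme of `X` given by `i`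
is contained, as a subscheme, in the one given by `j`, i.e. `i` factors through `j`. -/
def SubschemeLE {X Y Z : Scheme.{u}} (i : Z ⟶ X) (j : Y ⟶ X) : Prop :=
  ∃ g : Z ⟶ Y, g ≫ j = i

/-! The method is p-adic interpolation of orbits, in the style of Skolem, Mahler and Lech. Ideals
are finitely generated and intersections of primary ideals, and the finite-or-full dichotomy on
residue classes survives finite intersections. It thus suffices to study the `n` with `σ^n f ∈ I`,
for one element `f` and a primary ideal `I` of a finitely generated `ℚ`-algebra; descent to a
σ-stable subalgebra allows a general `K`.

By Noether normalization `A/I` embeds in a finite-dimensional `ℚ_[p]`-algebra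
(`exists_padic_embedding`). A σ-stable finitely generated ring `B` containing `f` then maps into a
finite `ℤ_[p]`-algebra `L`. Let `𝔞` be the preimage of `p²L`. As `B/𝔞²` is finite, some power `τ =
σ^N` is trivial modulo `𝔞²`, so `(τ - 1)^k f ∈ 𝔞^k` (`sub_mem_pow_succ`). Hence the coordinates of
`τ^n f = ∑ (n choose k) (τ - 1)^k f` have Mahler coefficients of size `O(p^(-2k))`, and Strassmann's
theorem (`LastMaxAt.finite_zeros`) leaves finitely many zeros or only zeros. Neither `I` nor `𝔞`
need be σ-stable.

For schemes, inclusion of closed subschemes is reverse inclusion of ideals of global functions. -/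

/-- For some modulus `N > 0`, every residue class either meets `S` in a finite set or is contained
in `S`. -/
def FiniteOrFullOnClasses (S : Set ℤ) : Prop :=
  ∃ N : ℕ, 0 < N ∧ ∀ r : ℤ, {n : ℤ | r + N * n ∈ S}.Finite ∨ ∀ n : ℤ, r + N * n ∈ S

/-! ### Combinatorics of the finite-or-full dichotomy. -/

theorem FiniteOrFullOnClasses.univ : FiniteOrFullOnClasses Set.univ :=
  ⟨1, one_pos, fun _ => Or.inr fun _ => trivial⟩

theorem FiniteOrFullOnClasses.exists_dvd {S : Set ℤ} {N : ℕ}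
    (h : ∀ r : ℤ, {n : ℤ | r + N * n ∈ S}.Finite ∨ ∀ n : ℤ, r + N * n ∈ S)
    {M : ℕ} (hM : 0 < M) (r : ℤ) :
    {n : ℤ | r + (N * M : ℕ) * n ∈ S}.Finite ∨ ∀ n : ℤ, r + (N * M : ℕ) * n ∈ S := by
  rcases h r with h | h
  · left
    refine (h.preimage (f := fun n : ℤ => (M : ℤ) * n) ?_).subset ?_
    · intro a _ b _ hab
      exact mul_left_cancel₀ (by exact_mod_cast hM.ne') hab
    · intro n hn
      simp only [Set.mem_preimage, Set.mem_ofPred_eq] at hn ⊢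
      rwa [← mul_assoc, ← Nat.cast_mul]
  · right
    intro n
    have := h (M * n)
    rwa [← mul_assoc, ← Nat.cast_mul] at this

theorem FiniteOrFullOnClasses.inter {S T : Set ℤ} (hS : FiniteOrFullOnClasses S)
    (hT : FiniteOrFullOnClasses T) : FiniteOrFullOnClasses (S ∩ T) := by
  obtain ⟨N, hN, hS⟩ := hS
  obtain ⟨M, hM, hT⟩ := hT
  refine ⟨N * M, Nat.mul_pos hN hM, fun r => ?_⟩
  have hT' := exists_dvd hT hN r
  rw [mul_comm M N] at hT'
  rcases exists_dvd hS hM r with h | h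
  · exact Or.inl (h.subset fun n hn => hn.1)
  · rcases hT' with h' | h'
    · exact Or.inl (h'.subset fun n hn => hn.2)
    · exact Or.inr fun n => ⟨h n, h' n⟩

theorem FiniteOrFullOnClasses.biInter {ι : Type*} (s : Finset ι) {S : ι → Set ℤ}
    (h : ∀ i ∈ s, FiniteOrFullOnClasses (S i)) : FiniteOrFullOnClasses (⋂ i ∈ s, S i) := by
  classical
  induction s using Finset.induction_on with
  | empty => simpa using FiniteOrFullOnClasses.univ
  | insert a s _ ih =>
    rw [Finset.set_biInter_insert]
    exact (h a (Finset.mem_insert_self a s)).inter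
      (ih fun i hi => h i (Finset.mem_insert_of_mem hi))

theorem FiniteOrFullOnClasses.hasTwoSidedSML {S : Set ℤ} (h : FiniteOrFullOnClasses S) :
    HasTwoSidedSML S := by
  classical
  obtain ⟨N, hN, h⟩ := h
  have hN' : (0 : ℤ) < N := by exact_mod_cast hN
  let full : Finset ℤ := (Finset.Ico (0 : ℤ) N).filter fun r => ∀ n : ℤ, r + N * n ∈ S
  let rest : Finset ℤ := (Finset.Ico (0 : ℤ) N).filter fun r => ¬ ∀ n : ℤ, r + N * n ∈ S
  refine ⟨full.image fun r => ((N : ℤ), r),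
    ⋃ r ∈ rest, (fun n : ℤ => r + N * n) '' {n : ℤ | r + N * n ∈ S}, ?_, ?_⟩
  · refine Set.Finite.biUnion rest.finite_toSet fun r hr => Set.Finite.image _ ?_
    exact (h r).resolve_right (Finset.mem_filter.1 hr).2
  · ext m
    have hm : m % N + N * (m / N) = m := Int.emod_add_mul_ediv m N
    have hmem : m % (N : ℤ) ∈ Finset.Ico (0 : ℤ) N :=
      Finset.mem_Ico.2 ⟨Int.emod_nonneg _ hN'.ne', Int.emod_lt_of_pos _ hN'⟩
    simp only [Set.mem_union, Set.mem_iUnion, Set.mem_ofPred_eq, Set.mem_image, exists_prop]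
    constructor
    · intro hmS
      by_cases hf : ∀ n : ℤ, m % (N : ℤ) + N * n ∈ S
      · refine Or.inl ⟨(N, m % N), Finset.mem_image.2 ⟨_, Finset.mem_filter.2 ⟨hmem, hf⟩, rfl⟩,
          m / N, ?_⟩
        rw [add_comm]
        exact hm.symm
      · exact Or.inr ⟨m % N, Finset.mem_filter.2 ⟨hmem, hf⟩, m / N, by rwa [hm], hm⟩
    · rintro (⟨q, hq, n, rfl⟩ | ⟨r, -, n, hn, rfl⟩)
      · obtain ⟨r, hr, rfl⟩ := Finset.mem_image.1 hq
        rw [add_comm]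
        exact (Finset.mem_filter.1 hr).2 n
      · exact hn

/-! ### Strassmann's theorem for falling factorial series. -/

section Strassmann

/-- The function `n ↦ ∑ c_k n (n - 1) ⋯ (n - k + 1)` on the natural numbers. -/
def descFactorialSum {K : Type*} [CommRing K] (c : ℕ → K) (n : ℕ) : K :=
  ∑ k ∈ Finset.range (n + 1), c k * (n.descFactorial k : K)

theorem descFactorialSum_zero {K : Type*} [CommRing K] (c : ℕ → K) :
    descFactorialSum c 0 = c 0 := by
  simp [descFactorialSum]

theorem descFactorialSum_succ {K : Type*} [CommRing K] (c : ℕ → K) (m : ℕ) :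
    descFactorialSum c (m + 1) =
      c 0 + ((m + 1 : ℕ) : K) * descFactorialSum (fun k => c (k + 1)) m := by
  rw [descFactorialSum, Finset.sum_range_succ', descFactorialSum, Finset.mul_sum, add_comm]
  congr 1
  · simp
  · refine Finset.sum_congr rfl fun k _ => ?_
    rw [Nat.succ_descFactorial_succ, Nat.cast_mul]
    ring

theorem descFactorialSum_shift {K : Type*} [CommRing K] (c : ℕ → K) (m : ℕ) :
    descFactorialSum (fun k => c k + ((k + 1 : ℕ) : K) * c (k + 1)) m =
      descFactorialSum c (m + 1) := by
  have hdesc (k : ℕ) (hk : k ≤ m) : ((m + 1 : ℕ) : K) * (m.descFactorial k : K) =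
      (m.descFactorial (k + 1) : K) + ((k + 1 : ℕ) : K) * (m.descFactorial k : K) := by
    rw [Nat.descFactorial_succ]
    obtain ⟨j, rfl⟩ := Nat.exists_eq_add_of_le hk
    rw [Nat.add_sub_cancel_left]
    push_cast
    ring
  rw [descFactorialSum_succ, descFactorialSum, descFactorialSum, Finset.mul_sum]
  have hsplit : ∑ k ∈ Finset.range (m + 1), c (k + 1) * (m.descFactorial (k + 1) : K) + c 0 =
      ∑ k ∈ Finset.range (m + 1), c k * (m.descFactorial k : K) := by
    have := Finset.sum_range_succ' (fun k => c k * (m.descFactorial k : K)) (m + 1)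
    rw [Finset.sum_range_succ] at this
    simpa using this.symm
  simp only [add_mul, Finset.sum_add_distrib]
  rw [← hsplit, add_right_comm, add_comm _ (c 0), ← Finset.sum_add_distrib]
  congr 1
  refine Finset.sum_congr rfl fun k hk => ?_
  linear_combination -c (k + 1) * hdesc k (Nat.lt_succ_iff.1 (Finset.mem_range.1 hk))

variable {K : Type*} [NormedField K]

/-- The maximum of `‖c k‖` is attained at `N`, and last there. -/
structure LastMaxAt (c : ℕ → K) (N : ℕ) : Prop where
  le : ∀ k, ‖c k‖ ≤ ‖c N‖
  lt : ∀ k, N < k → ‖c k‖ < ‖c N‖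

theorem exists_lastMaxAt {c : ℕ → K} (hc : Filter.Tendsto c Filter.atTop (nhds 0))
    (hne : ∃ k, c k ≠ 0) : ∃ N, LastMaxAt c N := by
  obtain ⟨k₀, hk₀⟩ := hne
  have hev : ∀ᶠ k in Filter.atTop, ‖c k‖ < ‖c k₀‖ :=
    (tendsto_norm_zero.comp hc).eventually (gt_mem_nhds (norm_pos_iff.2 hk₀))
  obtain ⟨M, hM⟩ := Filter.eventually_atTop.1 hev
  have hk₀M : k₀ < M := by
    by_contra h
    exact lt_irrefl _ (hM k₀ (not_lt.1 h))
  obtain ⟨a, ha, hmax⟩ := Finset.exists_max_image (Finset.range M) (fun k => ‖c k‖)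
    ⟨k₀, Finset.mem_range.2 hk₀M⟩
  have hle (k : ℕ) : ‖c k‖ ≤ ‖c a‖ := by
    rcases lt_or_ge k M with h | h
    · exact hmax k (Finset.mem_range.2 h)
    · exact (hM k h).le.trans (hmax k₀ (Finset.mem_range.2 hk₀M))
  classical
  have hex : ∃ b ∈ (Finset.range M).filter fun k => ‖c k‖ = ‖c a‖,
      ∀ x ∈ (Finset.range M).filter fun k => ‖c k‖ = ‖c a‖, id x ≤ id b :=
    Finset.exists_max_image _ id ⟨a, by simpa using Finset.mem_range.1 ha⟩
  obtain ⟨N, hN, hNmax⟩ := hex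
  have hNa := (Finset.mem_filter.1 hN).2
  refine ⟨N, ⟨fun k => hNa ▸ hle k, fun k hk => ?_⟩⟩
  refine lt_of_le_of_ne (hNa ▸ hle k) fun heq => ?_
  rcases lt_or_ge k M with h | h
  · have := hNmax k (Finset.mem_filter.2 ⟨Finset.mem_range.2 h, heq.trans hNa⟩)
    exact absurd hk (not_lt.2 this)
  · have h1 := hM k h
    rw [heq, hNa] at h1
    exact absurd (hle k₀) (not_le.2 h1)

variable [IsUltrametricDist K]

theorem norm_natCast_mul_le (n : ℕ) (x : K) : ‖(n : K) * x‖ ≤ ‖x‖ := by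
  rw [norm_mul]
  exact mul_le_of_le_one_left (norm_nonneg x) (IsUltrametricDist.norm_natCast_le_one K n)

/-- Integers have norm at most 1, so the added terms never exceed the maximum, and the one at `N` is
strictly smaller than `c N`. -/
theorem LastMaxAt.shift {c : ℕ → K} {N : ℕ} (h : LastMaxAt c N) :
    LastMaxAt (fun k => c k + ((k + 1 : ℕ) : K) * c (k + 1)) N := by
  have hN : ‖c N + ((N + 1 : ℕ) : K) * c (N + 1)‖ = ‖c N‖ := by
    have := (norm_natCast_mul_le (N + 1) (c (N + 1))).trans_lt (h.lt _ N.lt_succ_self)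
    rw [IsUltrametricDist.norm_add_eq_max_of_norm_ne_norm this.ne', max_eq_left this.le]
  refine ⟨fun k => ?_, fun k hk => ?_⟩
  · simp only [hN]
    exact (IsUltrametricDist.norm_add_le_max _ _).trans
      (max_le (h.le k) ((norm_natCast_mul_le _ _).trans (h.le _)))
  · simp only [hN]
    exact (IsUltrametricDist.norm_add_le_max _ _).trans_lt
      (max_lt (h.lt k hk) ((norm_natCast_mul_le _ _).trans_lt (h.lt _ (hk.trans k.lt_succ_self))))

theorem LastMaxAt.exists_translate {c : ℕ → K} {N : ℕ} (h : LastMaxAt c N) (n : ℕ) :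
    ∃ c' : ℕ → K, LastMaxAt c' N ∧
      ∀ m, descFactorialSum c' m = descFactorialSum c (m + n) := by
  induction n with
  | zero => exact ⟨c, h, fun m => rfl⟩
  | succ n ih =>
    obtain ⟨c', h', hc'⟩ := ih
    refine ⟨_, h'.shift, fun m => ?_⟩
    rw [descFactorialSum_shift, hc', add_right_comm, add_assoc]

/-- Strassmann's theorem for sums of falling factorials. -/
theorem LastMaxAt.finite_zeros [CharZero K] {N : ℕ} : ∀ {c : ℕ → K}, LastMaxAt c N →
    {n : ℕ | descFactorialSum c n = 0}.Finite := by
  induction N with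
  | zero =>
    intro c h
    convert Set.finite_empty
    refine Set.eq_empty_iff_forall_notMem.2 fun n (hn : descFactorialSum c n = 0) => ?_
    -- Translating the zero to the origin would force `c' 0 = 0`, but `c' 0` strictly dominates `c'
    -- 1`.
    obtain ⟨c', h', hc'⟩ := h.exists_translate n
    have h0 : c' 0 = 0 := by rw [← descFactorialSum_zero c', hc', zero_add, hn]
    have := (norm_nonneg _).trans_lt (h'.lt 1 one_pos)
    exact absurd this (by simp [h0])
  | succ N ih =>
    intro c h
    by_contra hinf
    obtain ⟨n, hn⟩ := Set.Infinite.nonempty hinf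
    obtain ⟨c', h', hc'⟩ := h.exists_translate n
    have h0 : c' 0 = 0 := by rw [← descFactorialSum_zero c', hc', zero_add]; exact hn
    -- With a zero moved to the origin, dividing by the variable lowers the index of the last
    -- maximum by one.
    have hlast : LastMaxAt (fun k => c' (k + 1)) N :=
      ⟨fun k => h'.le _, fun k hk => h'.lt _ (Nat.succ_lt_succ hk)⟩
    -- The translate only sees zeros beyond `n`; those up to `n` are finite in number anyway.
    refine hinf (Set.Finite.subset
      ((Set.finite_Iic n).union ((ih hlast).image fun m => m + 1 + n)) fun k hk => ?_)
    rcases le_or_gt k n with hkn | hkn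
    · exact Or.inl hkn
    · obtain ⟨m, rfl⟩ := Nat.exists_eq_add_of_lt hkn
      refine Or.inr ⟨m, ?_, by simp only; ring⟩
      have hz : descFactorialSum c' (m + 1) = 0 := by
        rw [hc', show m + 1 + n = n + m + 1 by ring]; exact hk
      rw [descFactorialSum_succ, h0, zero_add, mul_eq_zero] at hz
      exact hz.resolve_left (Nat.cast_ne_zero.2 m.succ_ne_zero)

end Strassmann

/-! ### Mahler expansions of orbits. -/

section PadicInterpolation

variable {p : ℕ} [Fact p.Prime]

theorem norm_inv_factorial_le (k : ℕ) : ‖((k.factorial : ℕ) : ℚ_[p])⁻¹‖ ≤ (p : ℝ) ^ k := by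
  have hp : (1 : ℝ) ≤ p := by exact_mod_cast (Fact.out : p.Prime).one_lt.le
  have hk : ((k.factorial : ℕ) : ℚ_[p]) ≠ 0 := by exact_mod_cast k.factorial_ne_zero
  rw [norm_inv, Padic.norm_eq_zpow_neg_valuation hk,
    Padic.valuation_natCast, zpow_neg, inv_inv, zpow_natCast]
  exact pow_le_pow_right₀ hp (padicValNat_factorial_le p k)

/-- A function on `ℕ` whose Mahler coefficients decay like `p ^ (-2k)` has finitely many zeros or
vanishes identically. -/
theorem finite_zeros_or_coeff_eq_zero {d : ℕ → ℚ_[p]} {M : ℝ}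
    (hd : ∀ k, ‖d k‖ ≤ M * ((p : ℝ)⁻¹) ^ (2 * k)) :
    {n : ℕ | ∑ k ∈ Finset.range (n + 1), (n.choose k : ℚ_[p]) * d k = 0}.Finite ∨
      ∀ k, d k = 0 := by
  by_cases hne : ∃ k, d k ≠ 0
  swap
  · exact Or.inr fun k => by_contra fun h => hne ⟨k, h⟩
  left
  have hp1 : (1 : ℝ) < p := by exact_mod_cast (Fact.out : p.Prime).one_lt
  have hp0 : (0 : ℝ) < p := one_pos.trans hp1
  have hfac (k : ℕ) : ((k.factorial : ℕ) : ℚ_[p]) ≠ 0 := by exact_mod_cast k.factorial_ne_zero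
  -- Passing from binomials to falling factorials divides by `k!`, costing at most `p^k` and leaving
  -- decay `p^(-k)`.
  let c : ℕ → ℚ_[p] := fun k => d k * ((k.factorial : ℕ) : ℚ_[p])⁻¹
  have hc (k : ℕ) : ‖c k‖ ≤ M * ((p : ℝ)⁻¹) ^ k := by
    have h1 : M * ((p : ℝ)⁻¹) ^ k = M * ((p : ℝ)⁻¹) ^ (2 * k) * (p : ℝ) ^ k := by
      rw [two_mul, pow_add, mul_assoc, mul_assoc, ← mul_pow, inv_mul_cancel₀ hp0.ne', one_pow,
        mul_one]
    rw [norm_mul, h1]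
    exact mul_le_mul (hd k) (norm_inv_factorial_le k) (norm_nonneg _)
      ((norm_nonneg _).trans (hd k))
  have hlim : Filter.Tendsto c Filter.atTop (nhds 0) := by
    refine squeeze_zero_norm hc ?_
    rw [← mul_zero M]
    exact (tendsto_pow_atTop_nhds_zero_of_lt_one (inv_nonneg.2 hp0.le)
      (inv_lt_one_of_one_lt₀ hp1)).const_mul M
  obtain ⟨k, hk⟩ := hne
  obtain ⟨N, hN⟩ := exists_lastMaxAt hlim ⟨k, mul_ne_zero hk (inv_ne_zero (hfac k))⟩
  refine hN.finite_zeros.subset fun n (hn : _ = 0) => ?_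
  change _ = _
  rw [← hn, descFactorialSum]
  refine Finset.sum_congr rfl fun j _ => ?_
  rw [Nat.descFactorial_eq_factorial_mul_choose, Nat.cast_mul]
  have := hfac j
  simp only [c]
  field_simp

variable {B : Type*} [CommRing B]

/-- The difference `τ - 1` of a ring automorphism, as an additive map. -/
def RingAut.difference (τ : RingAut B) : Module.End ℤ B :=
  (τ : B →+* B).toAddMonoidHom.toIntLinearMap - 1

theorem RingAut.difference_apply (τ : RingAut B) (b : B) : τ.difference b = τ b - b := rfl

/-- Binomial theorem for `τ = 1 + (τ - 1)`. -/
theorem RingAut.pow_apply_eq_sum (τ : RingAut B) (n : ℕ) (f : B) :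
    (τ ^ n) f = ∑ k ∈ Finset.range (n + 1), n.choose k • (τ.difference ^ k) f := by
  have h1 : ∀ m : ℕ, (τ ^ m) f = ((τ.difference + 1) ^ m) f := by
    intro m
    induction m with
    | zero => rfl
    | succ m ih =>
      rw [pow_succ', pow_succ', RingAut.mul_apply, Module.End.mul_apply, ← ih,
        LinearMap.add_apply, RingAut.difference_apply]
      simp
  rw [h1, (Commute.one_right τ.difference).add_pow]
  simp only [one_pow, mul_one, LinearMap.sum_apply]
  refine Finset.sum_congr rfl fun k _ => ?_
  rw [← (Nat.cast_commute (n.choose k) (τ.difference ^ k)).eq, Module.End.mul_apply]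
  simp

/-- Twisted Leibniz rule plus induction. Triviality modulo `𝔞²`, not just `𝔞`, is what makes `x (τ y
- y)` gain an extra power. -/
theorem sub_mem_pow_succ {𝔞 : Ideal B} {τ : RingAut B} (hτ : ∀ b, τ b - b ∈ 𝔞 ^ 2) (k : ℕ) :
    ∀ b ∈ 𝔞 ^ k, τ b - b ∈ 𝔞 ^ (k + 1) := by
  induction k with
  | zero =>
    intro b _
    exact Ideal.pow_le_pow_right one_le_two (hτ b)
  | succ k ih =>
    intro b hb
    rw [pow_succ] at hb
    refine Submodule.mul_induction_on hb (fun x hx y hy => ?_) fun x y hx hy => ?_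
    · have hmem : τ y ∈ 𝔞 := by
        rw [← sub_add_cancel (τ y) y]
        exact 𝔞.add_mem (Ideal.pow_le_self two_ne_zero (hτ y)) hy
      have : τ (x * y) - x * y = (τ x - x) * τ y + x * (τ y - y) := by rw [map_mul]; ring
      rw [this]
      refine Ideal.add_mem _ ?_ ?_
      · rw [pow_succ]
        exact Ideal.mul_mem_mul (ih x hx) hmem
      · rw [show k + 1 + 1 = k + 2 from rfl, pow_add]
        exact Ideal.mul_mem_mul hx (hτ y)
    · rw [map_add, add_sub_add_comm]
      exact Ideal.add_mem _ hx hy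

theorem eq_zero_of_infinite_nat_zeros {𝔞 : Ideal B} {τ : RingAut B}
    (hτ : ∀ b, τ b - b ∈ 𝔞 ^ 2) {l : B →+ ℚ_[p]} {M : ℝ}
    (hl : ∀ k, ∀ b ∈ 𝔞 ^ k, ‖l b‖ ≤ M * ((p : ℝ)⁻¹) ^ (2 * k)) (f : B)
    (hinf : {n : ℕ | l ((τ ^ n) f) = 0}.Infinite) (n : ℕ) : l ((τ ^ n) f) = 0 := by
  have hmem (k : ℕ) : (τ.difference ^ k) f ∈ 𝔞 ^ k := by
    induction k with
    | zero => simp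
    | succ k ih =>
      rw [pow_succ' τ.difference, Module.End.mul_apply]
      exact sub_mem_pow_succ hτ k _ ih
  have hsum (m : ℕ) : l ((τ ^ m) f) =
      ∑ k ∈ Finset.range (m + 1), (m.choose k : ℚ_[p]) * l ((τ.difference ^ k) f) := by
    rw [RingAut.pow_apply_eq_sum, map_sum]
    refine Finset.sum_congr rfl fun k _ => ?_
    rw [map_nsmul, nsmul_eq_mul]
  rcases finite_zeros_or_coeff_eq_zero (fun k => hl k _ (hmem k)) with h | h
  · simp only [← hsum] at h
    exact absurd h hinf
  · rw [hsum]
    exact Finset.sum_eq_zero fun k _ => by rw [h, mul_zero]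

/-- Negative times are reached by starting the orbit at `τ^(-m) f`, which still has infinitely many
zeros in forward time. -/
theorem eq_zero_of_infinite_nonneg_zeros {𝔞 : Ideal B} {τ : RingAut B}
    (hτ : ∀ b, τ b - b ∈ 𝔞 ^ 2) {l : B →+ ℚ_[p]} {M : ℝ}
    (hl : ∀ k, ∀ b ∈ 𝔞 ^ k, ‖l b‖ ≤ M * ((p : ℝ)⁻¹) ^ (2 * k)) (f : B)
    (hinf : {n : ℕ | l ((τ ^ n) f) = 0}.Infinite) (n : ℤ) : l ((τ ^ n) f) = 0 := by
  set m := n.natAbs with hm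
  have hinf' : {k : ℕ | l ((τ ^ k) ((τ ^ (-m : ℤ)) f)) = 0}.Infinite := by
    refine (hinf.image (f := fun k => k + m) (add_left_injective m).injOn).mono ?_
    rintro _ ⟨k, hk, rfl⟩
    change l ((τ ^ (k + m)) ((τ ^ (-m : ℤ)) f)) = 0
    rw [← RingAut.mul_apply, ← zpow_natCast, ← zpow_add, Nat.cast_add, add_neg_cancel_right,
      zpow_natCast]
    exact hk
  have := eq_zero_of_infinite_nat_zeros hτ hl _ hinf' (n + m).toNat
  rw [← RingAut.mul_apply, ← zpow_natCast, ← zpow_add, Int.toNat_of_nonneg (by omega)] at this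
  simpa using this

theorem finite_or_forall_zeros {𝔞 : Ideal B} {τ : RingAut B}
    (hτ : ∀ b, τ b - b ∈ 𝔞 ^ 2) {l : B →+ ℚ_[p]} {M : ℝ}
    (hl : ∀ k, ∀ b ∈ 𝔞 ^ k, ‖l b‖ ≤ M * ((p : ℝ)⁻¹) ^ (2 * k)) (f : B) :
    {n : ℤ | l ((τ ^ n) f) = 0}.Finite ∨ ∀ n : ℤ, l ((τ ^ n) f) = 0 := by
  by_cases hpos : {n : ℕ | l ((τ ^ n) f) = 0}.Infinite
  · exact Or.inr (eq_zero_of_infinite_nonneg_zeros hτ hl f hpos)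
  by_cases hneg : {n : ℕ | l ((τ⁻¹ ^ n) f) = 0}.Infinite
  · right
    intro n
    have hτ' : ∀ b, τ⁻¹ b - b ∈ 𝔞 ^ 2 := fun b => by
      have := neg_mem (hτ (τ⁻¹ b))
      rwa [← RingAut.mul_apply, mul_inv_cancel, RingAut.one_apply, neg_sub] at this
    have := eq_zero_of_infinite_nonneg_zeros hτ' hl f hneg (-n)
    rwa [inv_zpow', neg_neg] at this
  left
  refine (((Set.not_infinite.1 hpos).image fun n : ℕ => (n : ℤ)).union
    ((Set.not_infinite.1 hneg).image fun n : ℕ => (-n : ℤ))).subset fun n (hn : _ = 0) => ?_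
  rcases Int.eq_nat_or_neg n with ⟨m, rfl | rfl⟩
  · exact Or.inl ⟨m, by simpa using hn, rfl⟩
  · refine Or.inr ⟨m, ?_, rfl⟩
    change l _ = 0
    rwa [inv_pow, ← zpow_natCast, ← zpow_neg]

end PadicInterpolation

/-! ### Finite quotients and integral models over `ℤ_[p]`. -/

section IntegralModels

variable {B : Type*} [CommRing B]

theorem finite_ringHom_of_finiteType [Algebra.FiniteType ℤ B] (Q : Type*) [CommRing Q] [Finite Q] :
    Finite (B →+* Q) := by
  obtain ⟨s, hs⟩ := (inferInstance : Algebra.FiniteType ℤ B).out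
  refine Finite.of_injective (fun (h : B →+* Q) (x : s) => h x) fun g h hgh => ?_
  have : g.toIntAlgHom = h.toIntAlgHom :=
    AlgHom.ext_of_adjoin_eq_top hs fun x hx => congrFun hgh ⟨x, hx⟩
  ext b
  exact DFunLike.congr_fun this b

/-- Pigeonhole: two powers of `σ` agree as maps to the finite quotient; precomposing with an inverse
power cancels the smaller one, so `𝔟` need not be stable. -/
theorem exists_pow_sub_mem [Algebra.FiniteType ℤ B] (σ : RingAut B) (𝔟 : Ideal B)
    [Finite (B ⧸ 𝔟)] : ∃ N : ℕ, 0 < N ∧ ∀ b, (σ ^ N) b - b ∈ 𝔟 := by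
  have := finite_ringHom_of_finiteType (B := B) (B ⧸ 𝔟)
  obtain ⟨i, j, hij, h⟩ := Finite.exists_ne_map_eq_of_infinite
    fun n : ℕ => (Ideal.Quotient.mk 𝔟).comp ((σ ^ n : RingAut B) : B →+* B)
  wlog hlt : i < j generalizing i j
  · exact this j i hij.symm h.symm (lt_of_le_of_ne (not_lt.1 hlt) hij.symm)
  refine ⟨j - i, Nat.sub_pos_of_lt hlt, fun b => Ideal.Quotient.eq.1 ?_⟩
  have hb : Ideal.Quotient.mk 𝔟 ((σ ^ i) ((σ ^ i)⁻¹ b)) =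
      Ideal.Quotient.mk 𝔟 ((σ ^ j) ((σ ^ i)⁻¹ b)) := DFunLike.congr_fun h ((σ ^ i)⁻¹ b)
  rw [← RingAut.mul_apply, ← RingAut.mul_apply, mul_inv_cancel, RingAut.one_apply] at hb
  rw [hb, pow_sub σ hlt.le]

variable {p : ℕ} [Fact p.Prime] {L : Type*} [CommRing L] [Algebra ℤ_[p] L] [Module.Finite ℤ_[p] L]

theorem finite_quotient_span_prime_pow (k : ℕ) :
    Finite (L ⧸ Ideal.span {((p : L)) ^ k}) := by
  have h1 : Finite (ℤ_[p] ⧸ Ideal.span {(p : ℤ_[p]) ^ k}) := by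
    rw [← PadicInt.ker_toZModPow]
    exact Finite.of_injective _ (RingHom.kerLift_injective (PadicInt.toZModPow k))
  have h2 : (Ideal.span {(p : ℤ_[p]) ^ k}).map (algebraMap ℤ_[p] L) =
      Ideal.span {((p : L)) ^ k} := by
    rw [Ideal.map_span, Set.image_singleton, map_pow, map_natCast]
  rw [← h2]
  have : Module.Finite (ℤ_[p] ⧸ Ideal.span {(p : ℤ_[p]) ^ k})
      (L ⧸ (Ideal.span {(p : ℤ_[p]) ^ k}).map (algebraMap ℤ_[p] L)) := inferInstance
  exact Module.finite_of_finite (ℤ_[p] ⧸ Ideal.span {(p : ℤ_[p]) ^ k})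

theorem exists_norm_le (l : L →ₗ[ℤ_[p]] ℚ_[p]) : ∃ M : ℝ, 0 ≤ M ∧ ∀ x, ‖l x‖ ≤ M := by
  obtain ⟨s, hs⟩ := (inferInstance : Module.Finite ℤ_[p] L).fg_top
  refine ⟨∑ x ∈ s, ‖l x‖, Finset.sum_nonneg fun _ _ => norm_nonneg _, fun x => ?_⟩
  have hx : x ∈ Submodule.span ℤ_[p] (s : Set L) := hs ▸ Submodule.mem_top
  induction hx using Submodule.span_induction with
  | mem x hx => exact Finset.single_le_sum (f := fun x => ‖l x‖) (fun _ _ => norm_nonneg _) hx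
  | zero => simpa using Finset.sum_nonneg fun _ _ => norm_nonneg _
  | add x y _ _ hx hy =>
    rw [map_add]
    exact (IsUltrametricDist.norm_add_le_max _ _).trans (max_le hx hy)
  | smul a x _ hx =>
    rw [map_smul, Algebra.smul_def, norm_mul]
    exact (mul_le_of_le_one_left (norm_nonneg _) (PadicInt.norm_le_one a)).trans hx

omit [Module.Finite ℤ_[p] L] in
theorem norm_le_of_mem_pow_comap (T : B →+* L) {l : L →ₗ[ℤ_[p]] ℚ_[p]} {M : ℝ}
    (hl : ∀ x, ‖l x‖ ≤ M) (k : ℕ) (b : B)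
    (hb : b ∈ (Ideal.comap T (Ideal.span {(p : L) ^ 2})) ^ k) :
    ‖l (T b)‖ ≤ M * ((p : ℝ)⁻¹) ^ (2 * k) := by
  have h1 : T b ∈ Ideal.span {(p : L) ^ (2 * k)} := by
    rw [pow_mul, ← Ideal.span_singleton_pow]
    exact Ideal.le_comap_pow T k hb
  obtain ⟨y, hy⟩ := Ideal.mem_span_singleton'.1 h1
  have h2 : T b = (p : ℤ_[p]) ^ (2 * k) • y := by
    rw [← hy, Algebra.smul_def, map_pow, map_natCast, mul_comm]
  rw [h2, map_smul, Algebra.smul_def, norm_mul, mul_comm]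
  refine mul_le_mul (hl y) (le_of_eq ?_) (norm_nonneg _) ((norm_nonneg _).trans (hl y))
  rw [map_pow, map_natCast, norm_pow, Padic.norm_p]

theorem finiteOrFullOnClasses_linear_zeros [Algebra.FiniteType ℤ B] (σ : RingAut B) (T : B →+* L)
    {ι : Type*} [Fintype ι] (l : ι → L →ₗ[ℤ_[p]] ℚ_[p]) (f : B) :
    FiniteOrFullOnClasses {n : ℤ | ∀ i, l i (T ((σ ^ n) f)) = 0} := by
  have hB : IsNoetherianRing B := Algebra.FiniteType.isNoetherianRing ℤ B
  -- The square of `p` keeps the coefficients decaying after division by `k!`.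
  set 𝔞 := Ideal.comap T (Ideal.span {(p : L) ^ 2}) with h𝔞
  have hfin := finite_quotient_span_prime_pow (p := p) (L := L) 2
  have h1 : Finite (B ⧸ 𝔞) :=
    Finite.of_injective (Ideal.quotientMap _ T h𝔞.le) Ideal.quotientMap_injective
  have h2 : Finite (B ⧸ 𝔞 ^ 2) := Ideal.finite_quotient_pow (IsNoetherian.noetherian 𝔞) 2
  obtain ⟨N, hN, hσ⟩ := exists_pow_sub_mem σ (𝔞 ^ 2)
  have hone (i : ι) : FiniteOrFullOnClasses {n : ℤ | l i (T ((σ ^ n) f)) = 0} := by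
    obtain ⟨M, hM, hl⟩ := exists_norm_le (l i)
    refine ⟨N, hN, fun r => ?_⟩
    have h := finite_or_forall_zeros (l := (l i).toAddMonoidHom.comp T.toAddMonoidHom) hσ
      (fun k b hb => norm_le_of_mem_pow_comap T hl k b hb) ((σ ^ r) f)
    simp only [← zpow_natCast, ← zpow_mul, ← RingAut.mul_apply, ← zpow_add] at h
    simp only [Set.mem_ofPred_eq, add_comm r]
    exact h
  convert FiniteOrFullOnClasses.biInter Finset.univ fun i _ => hone i
  ext n
  simp

/-- The zero set of an orbit under a ring homomorphism to a finite-dimensional `ℚ_[p]`-algebra with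
integral image. -/
theorem finiteOrFullOnClasses_padic_zeros [Algebra.FiniteType ℤ B] (σ : RingAut B)
    {C : Type*} [CommRing C] [Algebra ℚ_[p] C] [Algebra ℤ_[p] C] [IsScalarTower ℤ_[p] ℚ_[p] C]
    [Module.Finite ℚ_[p] C] (T : B →+* C) (s : Set B) (hs : Algebra.adjoin ℤ s = ⊤)
    (hfin : s.Finite) (hT : ∀ b ∈ s, IsIntegral ℤ_[p] (T b)) (f : B) :
    FiniteOrFullOnClasses {n : ℤ | T ((σ ^ n) f) = 0} := by
  let L := Algebra.adjoin ℤ_[p] (T '' s)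
  have hL : Module.Finite ℤ_[p] L :=
    Module.Finite.iff_fg.2 (fg_adjoin_of_finite (hfin.image T) (by rintro _ ⟨b, hb, rfl⟩; exact hT b hb))
  have hmem (b : B) : T b ∈ L := by
    have hb : b ∈ Algebra.adjoin ℤ s := hs ▸ Algebra.mem_top
    induction hb using Algebra.adjoin_induction with
    | mem x hx => exact Algebra.subset_adjoin ⟨x, hx, rfl⟩
    | algebraMap n => simp
    | add x y _ _ hx hy => rw [map_add]; exact add_mem hx hy
    | mul x y _ _ hx hy => rw [map_mul]; exact mul_mem hx hy
  let T' : B →+* L := T.codRestrict L hmem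
  let e := Module.finBasis ℚ_[p] C
  let l : Fin (Module.finrank ℚ_[p] C) → L →ₗ[ℤ_[p]] ℚ_[p] := fun i =>
    ((e.coord i).restrictScalars ℤ_[p]).comp L.val.toLinearMap
  convert finiteOrFullOnClasses_linear_zeros σ T' l f using 4 with n
  rw [← e.forall_coord_eq_zero_iff]
  rfl

end IntegralModels

/-! ### Embedding into finite-dimensional p-adic algebras. -/

section PadicEmbedding

theorem not_countable_padicInt (p : ℕ) [Fact p.Prime] : ¬ Countable ℤ_[p] := by
  intro h
  have h1 : IsOpen (Metric.closedBall (0 : ℚ_[p]) 1) :=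
    IsUltrametricDist.isOpen_closedBall 0 one_ne_zero
  have h2 := continuum_le_cardinal_of_isOpen ℚ_[p] h1 ⟨0, by simp⟩
  have h3 : Countable (Metric.closedBall (0 : ℚ_[p]) 1) :=
    (Function.Injective.countable (β := ℤ_[p]) (f := fun x : Metric.closedBall (0 : ℚ_[p]) 1 =>
      (⟨x.1, mem_closedBall_zero_iff.1 x.2⟩ : ℤ_[p]))
      fun x y hxy => Subtype.ext (Subtype.mk.inj hxy))
  exact absurd (h2.trans (Cardinal.mk_le_aleph0_iff.2 h3)) (not_le.2 Cardinal.aleph0_lt_continuum)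

/-- A finite transcendence basis would make `ℤ_[p]` algebraic over a countable ring, hence
countable. -/
theorem exists_algebraicIndependent_padicInt (p : ℕ) [Fact p.Prime] (r : ℕ) :
    ∃ t : Fin r → ℤ_[p], AlgebraicIndependent ℤ t := by
  obtain ⟨s, hs⟩ := exists_isTranscendenceBasis ℤ ℤ_[p]
  have hinf : Infinite s := by
    by_contra hfin
    rw [not_infinite_iff_finite] at hfin
    have h1 : Countable (MvPolynomial s ℤ) := by
      rw [← Cardinal.mk_le_aleph0_iff]
      refine MvPolynomial.cardinalMk_le_max_lift.trans ?_
      simp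
    have h2 : Countable (Algebra.adjoin ℤ (Set.range ((↑) : s → ℤ_[p]))) :=
      hs.1.aevalEquiv.symm.injective.countable
    have h3 := hs.isAlgebraic
    have h4 := Algebra.IsAlgebraic.cardinalMk_le_max
      (Algebra.adjoin ℤ (Set.range ((↑) : s → ℤ_[p]))) ℤ_[p]
    rw [max_eq_right (Cardinal.mk_le_aleph0_iff.2 h2), Cardinal.mk_le_aleph0_iff] at h4
    exact not_countable_padicInt p h4
  obtain ⟨e⟩ : Nonempty (Fin r ↪ s) :=
    ⟨Fin.valEmbedding.trans (Infinite.natEmbedding s)⟩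
  exact ⟨_, hs.1.comp e e.injective⟩

theorem exists_int_mul_eq_map {r : ℕ} (q : MvPolynomial (Fin r) ℚ) :
    ∃ m : ℤ, m ≠ 0 ∧ ∃ y : MvPolynomial (Fin r) ℤ,
      (m : MvPolynomial (Fin r) ℚ) * q = MvPolynomial.map (algebraMap ℤ ℚ) y := by
  let := MvPolynomial.algebraMvPolynomial (R := ℤ) (S := ℚ) (σ := Fin r)
  have := MvPolynomial.isLocalization (σ := Fin r) (nonZeroDivisors ℤ) ℚ
  obtain ⟨⟨y, ⟨_, m, hm, rfl⟩⟩, h⟩ :=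
    IsLocalization.surj (Submonoid.map (MvPolynomial.C (σ := Fin r)) (nonZeroDivisors ℤ)) q
  refine ⟨m, nonZeroDivisors.ne_zero hm, y, ?_⟩
  rw [mul_comm]
  simpa using h

theorem aeval_rat_injective {p : ℕ} [Fact p.Prime] {r : ℕ} {t : Fin r → ℤ_[p]}
    (ht : AlgebraicIndependent ℤ t) :
    Function.Injective (MvPolynomial.aeval (R := ℚ) fun i => (t i : ℚ_[p])) := by
  rw [injective_iff_map_eq_zero]
  intro q hq
  obtain ⟨m, hm, y, hy⟩ := exists_int_mul_eq_map q
  have h1 : ((MvPolynomial.aeval t y : ℤ_[p]) : ℚ_[p]) =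
      MvPolynomial.aeval (R := ℚ) (fun i => (t i : ℚ_[p]))
        (MvPolynomial.map (algebraMap ℤ ℚ) y) := by
    rw [MvPolynomial.aeval_map_algebraMap]
    exact (MvPolynomial.aeval_algebraMap_apply (A := ℤ_[p]) ℚ_[p] t y).symm
  rw [← hy, map_mul, hq, mul_zero] at h1
  have h2 : y = 0 := by
    refine (injective_iff_map_eq_zero _).1 ht y ?_
    exact PadicInt.coe_eq_zero.1 h1
  rw [h2, map_zero, mul_eq_zero] at hy
  exact hy.resolve_left (by exact_mod_cast hm)

open TensorProduct in
-- `F` is flat over `P` through the fraction field. For `x ≠ 0` the map `P → R`, `q ↦ q x`, is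
-- injective, hence so is its base change, which sends `1` to `1 ⊗ x`.
theorem includeRight_injective_of_torsionFree {P F R : Type*} [CommRing P] [IsDomain P] [Field F]
    [Algebra P F] [CommRing R] [Algebra P R] (hF : Function.Injective (algebraMap P F))
    (hR : ∀ (q : P) (x : R), q ≠ 0 → algebraMap P R q * x = 0 → x = 0) :
    Function.Injective (Algebra.TensorProduct.includeRight : R →ₐ[P] F ⊗[P] R) := by
  have : FaithfulSMul P F := (faithfulSMul_iff_algebraMap_injective P F).2 hF
  let := FractionRing.liftAlgebra P F
  have hflat : Module.Flat P (FractionRing P) :=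
    IsLocalization.flat (FractionRing P) (nonZeroDivisors P)
  have hflat' : Module.Flat P F := Module.Flat.trans P (FractionRing P) F
  rw [injective_iff_map_eq_zero]
  intro x hx
  by_contra hne
  have h1 : Function.Injective (LinearMap.toSpanSingleton P R x) := by
    rw [injective_iff_map_eq_zero]
    intro q hq
    by_contra hq0
    rw [LinearMap.toSpanSingleton_apply, Algebra.smul_def] at hq
    exact hne (hR q x hq0 hq)
  have h2 := Module.Flat.lTensor_preserves_injective_linearMap (M := F) _ h1
  have h3 : LinearMap.lTensor F (LinearMap.toSpanSingleton P R x) ((1 : F) ⊗ₜ[P] (1 : P)) = 0 := by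
    rw [LinearMap.lTensor_tmul, LinearMap.toSpanSingleton_apply, one_smul]
    exact hx
  have h4 := (injective_iff_map_eq_zero _).1 h2 _ h3
  have h5 := congrArg (TensorProduct.rid P F) h4
  simp at h5

theorem exists_int_mul_isIntegral {R : Type*} [CommRing R] [Algebra ℚ R] {r : ℕ}
    (g : MvPolynomial (Fin r) ℚ →ₐ[ℚ] R) (x : R) (hx : g.toRingHom.IsIntegralElem x) :
    ∃ m : ℤ, m ≠ 0 ∧
      (g.toRingHom.comp (MvPolynomial.map (algebraMap ℤ ℚ))).IsIntegralElem (m * x) := by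
  let := MvPolynomial.algebraMvPolynomial (R := ℤ) (S := ℚ) (σ := Fin r)
  let := g.toRingHom.toAlgebra
  let : Algebra (MvPolynomial (Fin r) ℤ) R :=
    (g.toRingHom.comp (MvPolynomial.map (algebraMap ℤ ℚ))).toAlgebra
  have : IsScalarTower (MvPolynomial (Fin r) ℤ) (MvPolynomial (Fin r) ℚ) R :=
    IsScalarTower.of_algebraMap_eq fun _ => rfl
  have := MvPolynomial.isLocalization (σ := Fin r) (nonZeroDivisors ℤ) ℚ
  obtain ⟨⟨_, m, hm, rfl⟩, h⟩ := IsIntegral.exists_multiple_integral_of_isLocalization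
    (Submonoid.map (MvPolynomial.C (σ := Fin r)) (nonZeroDivisors ℤ)) (Rₘ := MvPolynomial (Fin r) ℚ) x hx
  refine ⟨m, nonZeroDivisors.ne_zero hm, ?_⟩
  rw [Submonoid.smul_def, Algebra.smul_def] at h
  have h0 : (m : R) = algebraMap (MvPolynomial (Fin r) ℤ) R (MvPolynomial.C m) :=
    (map_intCast ((algebraMap (MvPolynomial (Fin r) ℤ) R).comp MvPolynomial.C) m).symm
  rw [h0]
  exact h

theorem isUnit_intCast_padicInt {p : ℕ} [Fact p.Prime] {m : ℤ} (hm : m ≠ 0)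
    (hp : m.natAbs < p) : IsUnit (m : ℤ_[p]) := by
  rw [PadicInt.isUnit_iff, PadicInt.norm_intCast_eq_one_iff, Int.isCoprime_iff_gcd_eq_one,
    Int.gcd_comm]
  exact (Nat.Prime.coprime_iff_not_dvd (Fact.out : p.Prime)).2 fun h =>
    absurd (Nat.le_of_dvd (Int.natAbs_pos.2 hm) h) (not_le.2 hp)

open TensorProduct in
/-- A finitely generated `ℚ`-algebra whose zero divisors are nilpotent embeds into a
finite-dimensional algebra over some `ℚ_[p]`, with given finitely many elements integral over
`ℤ_[p]`. -/
theorem exists_padic_embedding (R : Type u) [CommRing R] [Nontrivial R] [Algebra ℚ R]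
    [Algebra.FiniteType ℚ R] (hR : ∀ x y : R, x * y = 0 → x = 0 ∨ IsNilpotent y) {s : Set R}
    (hs : s.Finite) :
    ∃ (p : ℕ) (_ : Fact p.Prime) (C : Type u) (_ : CommRing C) (_ : Algebra ℚ_[p] C)
      (_ : Algebra ℤ_[p] C) (_ : IsScalarTower ℤ_[p] ℚ_[p] C) (_ : Module.Finite ℚ_[p] C)
      (T : R →+* C), Function.Injective T ∧ ∀ x ∈ s, IsIntegral ℤ_[p] (T x) := by
  obtain ⟨r, g, hg, hfin⟩ := exists_finite_inj_algHom_of_fg ℚ R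
  choose m hm0 hm using fun x : R => exists_int_mul_isIntegral g x (hfin.to_isIntegral x)
  -- A prime above every denominator `m x`, `x ∈ s`, makes these integers units in `ℤ_[p]`.
  obtain ⟨p, hp, hprime⟩ := Nat.exists_infinite_primes (∑ x ∈ hs.toFinset, (m x).natAbs + 1)
  have hfact : Fact p.Prime := ⟨hprime⟩
  have hmp (x : R) (hx : x ∈ s) : (m x).natAbs < p :=
    lt_of_lt_of_le (Nat.lt_succ_of_le (Finset.single_le_sum (f := fun x => (m x).natAbs)
      (fun _ _ => Nat.zero_le _) (hs.mem_toFinset.2 hx))) hp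
  obtain ⟨t, ht⟩ := exists_algebraicIndependent_padicInt p r
  let h : MvPolynomial (Fin r) ℚ →ₐ[ℚ] ℚ_[p] := MvPolynomial.aeval fun i => (t i : ℚ_[p])
  let : Algebra (MvPolynomial (Fin r) ℚ) ℚ_[p] := h.toRingHom.toAlgebra
  let : Algebra (MvPolynomial (Fin r) ℚ) R := g.toRingHom.toAlgebra
  have hfin' : Module.Finite (MvPolynomial (Fin r) ℚ) R := hfin
  let C := ℚ_[p] ⊗[MvPolynomial (Fin r) ℚ] R
  let T : R →ₐ[MvPolynomial (Fin r) ℚ] C := Algebra.TensorProduct.includeRight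
  refine ⟨p, hfact, C, inferInstance, inferInstance, inferInstance,
    inferInstance, inferInstance, T.toRingHom, ?_, fun x hx => ?_⟩
  · refine includeRight_injective_of_torsionFree (aeval_rat_injective ht) fun q x hq hqx => ?_
    rw [mul_comm] at hqx
    -- A nonzero `q` is not nilpotent in `R`, since `g` is injective; hence it is not a zero
    -- divisor.
    refine (hR _ _ hqx).resolve_right fun ⟨n, hn⟩ => hq ?_
    have h1 : g (q ^ n) = 0 := by rw [map_pow]; exact hn
    exact eq_zero_of_pow_eq_zero ((injective_iff_map_eq_zero g).1 hg _ h1)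
  · have hcomm : (algebraMap ℤ_[p] C).comp (MvPolynomial.aeval (R := ℤ) t).toRingHom =
        T.toRingHom.comp (g.toRingHom.comp (MvPolynomial.map (algebraMap ℤ ℚ))) := by
      refine MvPolynomial.ringHom_ext (fun n => by simp) fun i => ?_
      have h1 : T (g (MvPolynomial.X i)) = algebraMap _ C (MvPolynomial.X i) := T.commutes _
      have h2 : algebraMap _ C (MvPolynomial.X i : MvPolynomial (Fin r) ℚ) =
          algebraMap ℚ_[p] C (algebraMap _ ℚ_[p] (MvPolynomial.X i)) :=
        IsScalarTower.algebraMap_apply _ _ _ _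
      have h3 : algebraMap (MvPolynomial (Fin r) ℚ) ℚ_[p] (MvPolynomial.X i) = t i :=
        MvPolynomial.aeval_X _ i
      simp only [RingHom.comp_apply, MvPolynomial.map_X]
      refine Eq.trans ?_ (h1.trans (h2.trans (by rw [h3]))).symm
      change algebraMap ℤ_[p] C (MvPolynomial.aeval t (MvPolynomial.X i)) = _
      rw [MvPolynomial.aeval_X]
      rfl
    obtain ⟨f, hf, hfx⟩ := hm x
    have h1 : IsIntegral ℤ_[p] (T (m x * x)) := by
      refine ⟨f.map (MvPolynomial.aeval (R := ℤ) t).toRingHom, hf.map _, ?_⟩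
      rw [Polynomial.eval₂_map, hcomm]
      change Polynomial.eval₂ _ (T.toRingHom _) f = 0
      rw [← Polynomial.hom_eval₂, hfx, map_zero]
    obtain ⟨u, hu⟩ := isUnit_intCast_padicInt (hm0 x) (hmp x hx)
    have h2 : T x = (↑u⁻¹ : ℤ_[p]) • T (m x * x) := by
      have h3 : T (m x * x) = (m x : ℤ_[p]) • T x := by
        rw [map_mul, map_intCast, Algebra.smul_def, map_intCast]
      rw [h3, ← hu, smul_smul, Units.inv_mul, one_smul]
    change IsIntegral ℤ_[p] (T x)
    rw [h2]
    exact h1.smul _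

end PadicEmbedding

/-! ### Descent of automorphisms and reduction to primary ideals. -/

section Automorphisms

theorem map_zpow_smul {G H X Y : Type*} [Group G] [Group H] [MulAction G X] [MulAction H Y]
    {g : G} {h : H} {j : X → Y} (hj : ∀ x, j (g • x) = h • j x) (n : ℤ) (x : X) :
    j (g ^ n • x) = h ^ n • j x := by
  have hinv : ∀ x, j (g⁻¹ • x) = h⁻¹ • j x := fun x => by
    rw [eq_inv_smul_iff, ← hj, smul_inv_smul]
  induction n using Int.induction_on generalizing x with
  | zero => simp
  | succ n ih => rw [zpow_add_one, zpow_add_one, mul_smul, mul_smul, ih, hj]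
  | pred n ih => rw [zpow_sub_one, zpow_sub_one, mul_smul, mul_smul, ih, hinv]

variable {A : Type*} [CommRing A]

theorem exists_finite_mem_adjoin (k : Type*) {K : Type*} [CommRing k] [CommRing K] [Algebra k K]
    [Algebra K A] [Algebra k A] {a : Set A} (ha : Algebra.adjoin K a = ⊤) (x : A) :
    ∃ c : Set K, c.Finite ∧ x ∈ Algebra.adjoin k (a ∪ algebraMap K A '' c) := by
  have hmono {c d : Set K} (hcd : c ⊆ d) :
      Algebra.adjoin k (a ∪ algebraMap K A '' c) ≤ Algebra.adjoin k (a ∪ algebraMap K A '' d) :=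
    Algebra.adjoin_mono (Set.union_subset_union_right _ (Set.image_mono hcd))
  have hx : x ∈ Algebra.adjoin K a := ha ▸ Algebra.mem_top
  induction hx using Algebra.adjoin_induction with
  | mem x hx => exact ⟨∅, Set.finite_empty, Algebra.subset_adjoin (Or.inl hx)⟩
  | algebraMap y =>
    exact ⟨{y}, Set.finite_singleton y, Algebra.subset_adjoin (Or.inr ⟨y, rfl, rfl⟩)⟩
  | add x y _ _ hx hy =>
    obtain ⟨c, hc, hx⟩ := hx
    obtain ⟨d, hd, hy⟩ := hy
    exact ⟨c ∪ d, hc.union hd, add_mem (hmono Set.subset_union_left hx)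
      (hmono Set.subset_union_right hy)⟩
  | mul x y _ _ hx hy =>
    obtain ⟨c, hc, hx⟩ := hx
    obtain ⟨d, hd, hy⟩ := hy
    exact ⟨c ∪ d, hc.union hd, mul_mem (hmono Set.subset_union_left hx)
      (hmono Set.subset_union_right hy)⟩

/-- An automorphism fixing the scalars descends to a finitely generated algebra over a smaller ring
of scalars. -/
theorem exists_stable_adjoin (k K : Type*) [CommRing k] [CommRing K] [Algebra k K]
    [Algebra K A] [Algebra k A] [IsScalarTower k K A] [Algebra.FiniteType K A] (σ : RingAut A)
    (hσ : ∀ y, σ (algebraMap K A y) = algebraMap K A y) (f : A) :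
    ∃ G : Set A, G.Finite ∧ f ∈ Algebra.adjoin k G ∧
      ∃ ρ : RingAut (Algebra.adjoin k G), ∀ b, (ρ b : A) = σ b := by
  obtain ⟨a, ha⟩ := (inferInstance : Algebra.FiniteType K A).out
  choose c hc hmem using exists_finite_mem_adjoin k (K := K) ha
  -- Including the images of the generators under both `σ` and its inverse makes the subalgebra
  -- stable in both directions.
  let Y : Set A := {f} ∪ (σ '' a ∪ (σ⁻¹ : RingAut A) '' a)
  have hY : Y.Finite :=
    (Set.finite_singleton f).union ((a.finite_toSet.image _).union (a.finite_toSet.image _))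
  let d : Set K := ⋃ y ∈ Y, c y
  have hd : d.Finite := hY.biUnion fun y _ => hc y
  let G : Set A := a ∪ algebraMap K A '' d
  have hYG (y : A) (hy : y ∈ Y) : y ∈ Algebra.adjoin k G :=
    Algebra.adjoin_mono (Set.union_subset_union_right _
      (Set.image_mono (Set.subset_biUnion_of_mem hy))) (hmem y)
  have hstable (τ : RingAut A) (hτ : ∀ y, τ (algebraMap K A y) = algebraMap K A y)
      (hτa : ∀ x ∈ a, τ x ∈ Algebra.adjoin k G) :
      ∀ b ∈ Algebra.adjoin k G, τ b ∈ Algebra.adjoin k G := by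
    intro b hb
    induction hb using Algebra.adjoin_induction with
    | mem x hx =>
      rcases hx with hx | ⟨y, hy, rfl⟩
      · exact hτa x hx
      · rw [hτ]
        exact Algebra.subset_adjoin (Or.inr ⟨y, hy, rfl⟩)
    | algebraMap y =>
      rw [IsScalarTower.algebraMap_apply k K A, hτ, ← IsScalarTower.algebraMap_apply]
      exact Subalgebra.algebraMap_mem _ y
    | add x y _ _ hx hy => rw [map_add]; exact add_mem hx hy
    | mul x y _ _ hx hy => rw [map_mul]; exact mul_mem hx hy
  have h1 := hstable σ hσ fun x hx => hYG _ (Or.inr (Or.inl ⟨x, hx, rfl⟩))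
  have h2 := hstable σ⁻¹
    (fun y => by
      conv_lhs => rw [← hσ y]
      rw [← RingAut.mul_apply, inv_mul_cancel, RingAut.one_apply])
    fun x hx => hYG _ (Or.inr (Or.inr ⟨x, hx, rfl⟩))
  refine ⟨G, a.finite_toSet.union (hd.image _), hYG f (Or.inl rfl), ?_⟩
  exact ⟨{ toFun := fun b => ⟨σ b, h1 b b.2⟩
           invFun := fun b => ⟨σ⁻¹ b, h2 b b.2⟩
           left_inv := fun b => Subtype.ext (σ.symm_apply_apply b)
           right_inv := fun b => Subtype.ext (σ.apply_symm_apply b)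
           map_mul' := fun x y => Subtype.ext (map_mul σ _ _)
           map_add' := fun x y => Subtype.ext (map_add σ _ _) }, fun b => rfl⟩

theorem finiteOrFullOnClasses_of_isPrimary [Algebra ℚ A] [Algebra.FiniteType ℚ A]
    (σ : RingAut A) {I : Ideal A} (hI : I.IsPrimary) (f : A) :
    FiniteOrFullOnClasses {n : ℤ | (σ ^ n) f ∈ I} := by
  obtain ⟨hne, hI⟩ := Ideal.isPrimary_iff.1 hI
  obtain ⟨G, hG, hf, ρ, hρ⟩ := exists_stable_adjoin ℤ ℚ σ (fun y => (σ : A →+* A).toRatAlgHom.commutes y) f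
  have : Nontrivial (A ⧸ I) := Ideal.Quotient.nontrivial_iff.2 hne
  have hR : ∀ x y : A ⧸ I, x * y = 0 → x = 0 ∨ IsNilpotent y := by
    intro x y
    obtain ⟨x, rfl⟩ := Ideal.Quotient.mk_surjective x
    obtain ⟨y, rfl⟩ := Ideal.Quotient.mk_surjective y
    rw [← map_mul, Ideal.Quotient.eq_zero_iff_mem, Ideal.Quotient.eq_zero_iff_mem]
    refine fun h => (hI h).imp_right fun ⟨n, hn⟩ => ⟨n, ?_⟩
    rw [← map_pow]
    exact Ideal.Quotient.eq_zero_iff_mem.2 hn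
  obtain ⟨p, hp, C, _, _, _, _, _, T, hT, hint⟩ :=
    exists_padic_embedding (A ⧸ I) hR (hG.image (Ideal.Quotient.mk I))
  have hgen := Algebra.adjoin_adjoin_coe_preimage (R := ℤ) (s := G)
  have hfin : (((↑) : Algebra.adjoin ℤ G → A) ⁻¹' G).Finite :=
    hG.preimage Subtype.val_injective.injOn
  have : Algebra.FiniteType ℤ (Algebra.adjoin ℤ G) := ⟨⟨hfin.toFinset, by simp⟩⟩
  convert finiteOrFullOnClasses_padic_zeros ρ
    (T.comp ((Ideal.Quotient.mk I).comp (Algebra.adjoin ℤ G).val.toRingHom)) _ hgen hfin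
    (fun b hb => hint _ ⟨b, hb, rfl⟩) ⟨f, hf⟩ using 3 with n
  have h1 : (((ρ ^ n) ⟨f, hf⟩ : Algebra.adjoin ℤ G) : A) = (σ ^ n) f :=
    map_zpow_smul (g := ρ) (h := σ) (j := ((↑) : Algebra.adjoin ℤ G → A)) hρ n ⟨f, hf⟩
  change _ ↔ T (Ideal.Quotient.mk I (((ρ ^ n) ⟨f, hf⟩ : Algebra.adjoin ℤ G) : A)) = 0
  rw [h1, map_eq_zero_iff T hT, Ideal.Quotient.eq_zero_iff_mem]

theorem finiteOrFullOnClasses_mem_of_rat [Algebra ℚ A] [Algebra.FiniteType ℚ A]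
    (σ : RingAut A) (I : Ideal A) (f : A) :
    FiniteOrFullOnClasses {n : ℤ | (σ ^ n) f ∈ I} := by
  have : IsNoetherianRing A := Algebra.FiniteType.isNoetherianRing ℚ A
  obtain ⟨s, rfl, hs⟩ := Submodule.isLasker A A I
  convert FiniteOrFullOnClasses.biInter s fun J hJ =>
    finiteOrFullOnClasses_of_isPrimary σ (hs hJ) f
  ext n
  simp [Submodule.mem_finsetInf]

theorem finiteOrFullOnClasses_mem (K : Type*) [Field K] [CharZero K] [Algebra K A]
    [Algebra.FiniteType K A] (σ : RingAut A)
    (hσ : ∀ y, σ (algebraMap K A y) = algebraMap K A y) (I : Ideal A) (f : A) :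
    FiniteOrFullOnClasses {n : ℤ | (σ ^ n) f ∈ I} := by
  let : Algebra ℚ A := ((algebraMap K A).comp (algebraMap ℚ K)).toAlgebra
  have : IsScalarTower ℚ K A := IsScalarTower.of_algebraMap_eq fun _ => rfl
  obtain ⟨G, hG, hf, ρ, hρ⟩ := exists_stable_adjoin ℚ K σ hσ f
  have hfin : (((↑) : Algebra.adjoin ℚ G → A) ⁻¹' G).Finite :=
    hG.preimage Subtype.val_injective.injOn
  have : Algebra.FiniteType ℚ (Algebra.adjoin ℚ G) :=
    ⟨⟨hfin.toFinset, by simp⟩⟩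
  convert finiteOrFullOnClasses_mem_of_rat ρ
    (I.comap (Algebra.adjoin ℚ G).val.toRingHom) ⟨f, hf⟩ using 3 with n
  have h1 : (((ρ ^ n) ⟨f, hf⟩ : Algebra.adjoin ℚ G) : A) = (σ ^ n) f :=
    map_zpow_smul (g := ρ) (h := σ) (j := ((↑) : Algebra.adjoin ℚ G → A)) hρ n ⟨f, hf⟩
  change _ ↔ (((ρ ^ n) ⟨f, hf⟩ : Algebra.adjoin ℚ G) : A) ∈ I
  rw [h1]

theorem finiteOrFullOnClasses_forall_mem (K : Type*) [Field K] [CharZero K] [Algebra K A]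
    [Algebra.FiniteType K A] (σ : A ≃ₐ[K] A) (I J : Ideal A) :
    FiniteOrFullOnClasses {n : ℤ | ∀ f ∈ J, (σ ^ n) f ∈ I} := by
  have : IsNoetherianRing A := Algebra.FiniteType.isNoetherianRing K A
  obtain ⟨s, rfl⟩ := IsNoetherian.noetherian J
  let τ : RingAut A := σ.toRingEquiv
  have hτ (n : ℤ) (f : A) : (τ ^ n) f = (σ ^ n) f :=
    map_zpow_smul (g := τ) (h := σ) (j := fun a : A => a) (fun _ => rfl) n f
  convert FiniteOrFullOnClasses.biInter s fun f _ =>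
    finiteOrFullOnClasses_mem K τ (fun y => σ.commutes y) I f
  ext n
  simp only [Set.mem_ofPred_eq, Set.mem_iInter, hτ]
  -- The preimage of `I` is an ideal, so testing generators of `J` suffices.
  exact Submodule.span_le (p := I.comap (σ ^ n))

end Automorphisms

/-! ### Closed subschemes and global functions. -/

section Schemes

theorem subschemeLE_iff_ker_le {X Y Z : Scheme.{u}} [IsAffine X] (i : Z ⟶ X) (j : Y ⟶ X)
    [IsClosedImmersion j] :
    SubschemeLE i j ↔ RingHom.ker j.appTop.hom ≤ RingHom.ker i.appTop.hom := by
  constructor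
  · rintro ⟨g, rfl⟩
    rw [Scheme.Hom.comp_appTop, CommRingCat.hom_comp, ← RingHom.comap_ker]
    exact Ideal.ker_le_comap _
  · intro h
    have h1 : j.ker ≤ i.ker := by
      rw [Scheme.ker_of_isAffine, Scheme.ker_of_isAffine]
      exact (map_le_map_iff (Scheme.IdealSheafData.equivOfIsAffine (X := X)).symm).2 h
    exact ⟨IsClosedImmersion.lift j i h1, IsClosedImmersion.lift_fac j i h1⟩

variable {K : Type u} [Field K] (X : Over (Spec (CommRingCat.of K)))

/-- The structure map of the ring of global functions of a scheme over a field. -/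
noncomputable def globalSectionsStructure : CommRingCat.of K ⟶ Γ(X.left, ⊤) :=
  (Scheme.ΓSpecIso (CommRingCat.of K)).inv ≫ X.hom.appTop

noncomputable instance globalSectionsAlgebra : Algebra K Γ(X.left, ⊤) :=
  (globalSectionsStructure X).hom.toAlgebra

theorem finiteType_globalSections [IsAffine X.left] [LocallyOfFiniteType X.hom] :
    Algebra.FiniteType K Γ(X.left, ⊤) := by
  have h1 : X.hom.appTop.hom.FiniteType :=
    HasRingHomProperty.appTop @LocallyOfFiniteType X.hom inferInstance
  have h2 : (Scheme.ΓSpecIso (CommRingCat.of K)).inv.hom.FiniteType :=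
    RingHom.FiniteType.of_surjective _ (ConcreteCategory.bijective_of_isIso
      (Scheme.ΓSpecIso (CommRingCat.of K)).inv).2
  exact h1.comp h2

variable {X}

theorem appTop_left_algebraMap (f : X ⟶ X) (y : K) :
    f.left.appTop (algebraMap K Γ(X.left, ⊤) y) = algebraMap K Γ(X.left, ⊤) y := by
  have h1 : globalSectionsStructure X ≫ f.left.appTop = globalSectionsStructure X := by
    rw [globalSectionsStructure, Category.assoc, ← Scheme.Hom.comp_appTop, Over.w]
  exact ConcreteCategory.congr_hom h1 y

theorem appTop_left_comp_apply (f g : X ⟶ X) (a : Γ(X.left, ⊤)) :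
    (f ≫ g).left.appTop a = f.left.appTop (g.left.appTop a) := by
  rw [Over.comp_left, Scheme.Hom.comp_appTop]
  rfl

theorem appTop_left_id_apply (a : Γ(X.left, ⊤)) : (𝟙 X : X ⟶ X).left.appTop a = a := by
  simp

/-- The action of automorphisms on global functions by pullback along the inverse. -/
noncomputable def autGlobalSections : Aut X →* (Γ(X.left, ⊤) ≃ₐ[K] Γ(X.left, ⊤)) where
  toFun σ := AlgEquiv.ofRingEquiv (f := RingEquiv.ofRingHom σ.inv.left.appTop.hom
    σ.hom.left.appTop.hom
    (RingHom.ext fun a => by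
      have := appTop_left_comp_apply σ.inv σ.hom a
      rw [show σ.inv ≫ σ.hom = 𝟙 X from Iso.inv_hom_id σ, appTop_left_id_apply] at this
      exact this.symm)
    (RingHom.ext fun a => by
      have := appTop_left_comp_apply σ.hom σ.inv a
      rw [show σ.hom ≫ σ.inv = 𝟙 X from Iso.hom_inv_id σ, appTop_left_id_apply] at this
      exact this.symm)) fun y => appTop_left_algebraMap σ.inv y
  map_one' := AlgEquiv.ext fun a => appTop_left_id_apply a
  map_mul' σ τ := AlgEquiv.ext fun a => appTop_left_comp_apply σ.inv τ.inv a

/-- The inverse cancels the one that turns contravariant pullback into a homomorphism. -/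
theorem autGlobalSections_inv_zpow_apply (σ : Aut X) (n : ℤ) (a : Γ(X.left, ⊤)) :
    (autGlobalSections σ⁻¹ ^ n) a = (σ ^ n).hom.left.appTop a := by
  rw [← map_zpow, inv_zpow]
  rfl

end Schemes

/-! ### The algebraic and geometric statements. -/

theorem theorem1p5 (K : Type u) [Field K] [CharZero K] :
    (∀ (A : Type v) [CommRing A] [Algebra K A] [Algebra.FiniteType K A]
        (σ : A ≃ₐ[K] A) (I J : Ideal A),
      HasTwoSidedSML {n : ℤ | (J : Set A) ⊆ (fun a : A => (σ ^ n) a) '' (I : Set A)}) ∧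
    (∀ (X : Over (Spec (CommRingCat.of K))) [IsAffine X.left] [LocallyOfFiniteType X.hom]
        (σ : Aut X) (Y Z : Scheme.{u}) (iY : Y ⟶ X.left) (iZ : Z ⟶ X.left)
        [IsClosedImmersion iY] [IsClosedImmersion iZ],
      HasTwoSidedSML {n : ℤ | SubschemeLE (iZ ≫ (σ ^ n).hom.left) iY}) := by
  constructor
  · intro A _ _ _ σ I J
    -- `J ⊆ σ^n(I)` means that `σ^(-n)` carries `J` into `I`.
    convert (finiteOrFullOnClasses_forall_mem K σ⁻¹ I J).hasTwoSidedSML using 3 with n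
    refine forall₂_congr fun f _ => ⟨?_, fun h => ⟨_, h, ?_⟩⟩
    · rintro ⟨a, ha, rfl⟩
      change (σ⁻¹ ^ n) ((σ ^ n) a) ∈ I
      rwa [← AlgEquiv.mul_apply, inv_zpow, inv_mul_cancel, AlgEquiv.one_apply]
    · change (σ ^ n) ((σ⁻¹ ^ n) f) = f
      rw [← AlgEquiv.mul_apply, inv_zpow, mul_inv_cancel, AlgEquiv.one_apply]
  · intro X _ _ σ Y Z iY iZ _ _
    have := finiteType_globalSections X
    -- The inclusion says that pullback along `σ^n` carries the ideal of `Y` into the ideal of `Z`.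
    convert (finiteOrFullOnClasses_forall_mem K (autGlobalSections σ⁻¹)
      (RingHom.ker iZ.appTop.hom) (RingHom.ker iY.appTop.hom)).hasTwoSidedSML using 3 with n
    rw [subschemeLE_iff_ker_le]
    refine forall₂_congr fun f _ => ?_
    rw [RingHom.mem_ker, RingHom.mem_ker, autGlobalSections_inv_zpow_apply,
      Scheme.Hom.comp_appTop]
    rfl
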